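/- Let $K$ be an oriented (smooth) knot in $S^3$, let $E_K=S^3\setminus\nu(K)$ be its exterior, where $\nu(K)$ is an open tubular neighbourhood of $K$, and let $G(K)=\pi_1(E_K)$. Let $\phi\colon G(K)\to\mathbb Z=\langle t\rangle$ be the abelianization that sends an oriented meridian to $t$. Fix a Wirtinger presentation $G(K)=\langle s_1,\dots,s_n\mid r_1,\dots,r_{n-1}\rangle$. For a representation $\varrho\colon G(K)\to \mathrm{GL}(k,\mathbb Z)$ let $\Phi\colon\mathbb Z[F_n]\to \mathrm{Mat}(k,\mathbb Z[t^{\pm1}])$ be the ring homomorphism induced by $s\mapsto\phi(s)\varrho(s)$. The twisted Alexander polynomial of $K$ associated with $\varrho$ is $$\Delta_K^{\varrho}(t)=\frac{\det M_j}{\det\Phi(s_j-1)}\in\mathbb Q(t),$$ where $M_j$ is obtained from the block matrix $\bigl(\Phi(\partial r_i/\partial s_l)\bigr)_{i,l}$ of free differentials by removing the $j$-th block column; it is well defined up to multiplication by $\pm t^l$ $(l\in\mathbb Z)$. A finite group $G$ with regular representation $\rho\colon G\to\mathrm{GL}(|G|,\mathbb Z)$ is called a twisted Alexander vanishing (TAV)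 group of $K$ if there is an epimorphism $f\colon G(K)\to G$ with $\Delta_K^{\rho\circ f}(t)=0$, and a TAV group if it is a TAV group of some knot. The TAV order $\mathcal O(K)\in\mathbb N\cup\{+\infty\}$ is the least order of a TAV group of $K$ if $K$ is not fibered, and $\mathcal O(K)=+\infty$ if $K$ is fibered. Theorem. For every knot $K$ in $S^3$ we have $\mathcal O(K)\ge 24$. Moreover, no finite group of order less than $24$ is a TAV group. -/

import Mathlib

open scoped Manifold ContDiff

noncomputable section

/-! ### Fox calculus -/

section FoxCalculus

variable {ι : Type*} [DecidableEq ι]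

/-- The Fox derivative with respect to `s j` of the word `w` in the letters `s i` (that is
`(i, true)`) and `(s i)⁻¹` (that is `(i, false)`):
`∂(x w) = ∂ x + x ∂ w`, `∂ (s i) = δ i j` and `∂ (s i)⁻¹ = - δ i j (s i)⁻¹`. -/
def foxWord (j : ι) : List (ι × Bool) → MonoidAlgebra ℤ (FreeGroup ι)
  | [] => 0
  | (i, true) :: w =>
      (if i = j then 1 else 0) + MonoidAlgebra.of ℤ _ (FreeGroup.of i) * foxWord j w
  | (i, false) :: w =>
      (if i = j then -MonoidAlgebra.of ℤ _ (FreeGroup.of i)⁻¹ else 0)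
        + MonoidAlgebra.of ℤ _ (FreeGroup.of i)⁻¹ * foxWord j w

lemma foxWord_append (j : ι) (u v : List (ι × Bool)) :
    foxWord j (u ++ v) =
      foxWord j u + MonoidAlgebra.of ℤ _ (FreeGroup.mk u) * foxWord j v := by
  induction u with
  | nil =>
    have h : (FreeGroup.mk ([] : List (ι × Bool))) = 1 := rfl
    rw [h, map_one, one_mul]
    simp [foxWord]
  | cons a u ih =>
    obtain ⟨i, b⟩ := a
    have h : FreeGroup.mk ((i, b) :: u) = FreeGroup.mk [(i, b)] * FreeGroup.mk u := rfl
    cases b with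
    | true =>
      have h' : FreeGroup.mk [(i, true)] = FreeGroup.of i := rfl
      rw [h, h', map_mul, List.cons_append, foxWord, foxWord, ih, mul_add, add_assoc, mul_assoc]
    | false =>
      have h' : FreeGroup.mk [(i, false)] = (FreeGroup.of i)⁻¹ := rfl
      rw [h, h', map_mul, List.cons_append, foxWord, foxWord, ih, mul_add, add_assoc, mul_assoc]

lemma foxWord_step (j : ι) {u v : List (ι × Bool)} (h : FreeGroup.Red.Step u v) :
    foxWord j u = foxWord j v := by
  obtain ⟨⟩ := h
  rename_i u v i b
  rw [foxWord_append, foxWord_append]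
  congr 2
  cases b
  · simp only [Bool.not_false, foxWord, mul_add, ← mul_assoc, ← map_mul, inv_mul_cancel, map_one,
      one_mul, ← add_assoc]
    split_ifs <;> simp
  · simp only [Bool.not_true, foxWord, mul_add, ← mul_assoc, ← map_mul, mul_inv_cancel, map_one,
      one_mul, ← add_assoc]
    split_ifs
    · rw [mul_neg, ← map_mul, mul_inv_cancel, map_one]; simp
    · simp

/-- The free differential `∂ / ∂ s_j : F → ℤ[F]` on the free group `F` on the letters `s_i`. -/
def foxDeriv (j : ι) (w : FreeGroup ι) : MonoidAlgebra ℤ (FreeGroup ι) :=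
  Quot.lift (foxWord j) (fun _ _ h => foxWord_step j h) w

lemma foxDeriv_of (i j : ι) : foxDeriv j (FreeGroup.of i) = if i = j then 1 else 0 := by
  change foxWord j [(i, true)] = _
  simp [foxWord]

lemma foxDeriv_mul (j : ι) (u v : FreeGroup ι) :
    foxDeriv j (u * v) = foxDeriv j u + MonoidAlgebra.of ℤ _ u * foxDeriv j v := by
  induction u using Quot.ind
  induction v using Quot.ind
  exact foxWord_append j _ _

end FoxCalculus

/-! ### Wirtinger presentations and twisted Alexander polynomials

In this section `Γ` is a group with a distinguished element `μ`; below it is applied to the group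
of an oriented knot and an oriented meridian. -/

section TwistedAlexander

/-- A Wirtinger presentation `⟨s_0, …, s_m ∣ r_0, …, r_{m-1}⟩` of `Γ`: every generator is
(conjugate to) the meridian `μ`, and every relator is the relator
`s_i^{±1} s_j s_i^{∓1} s_k⁻¹` of a crossing at which the arc `i` passes over and the arcs
`j`, `k` pass under. -/
structure WirtingerPresentation (Γ : Type*) [Group Γ] (μ : Γ) where
  /-- the number of relators; there is one generator more -/
  m : ℕ
  /-- the relators -/
  rel : Fin m → FreeGroup (Fin (m + 1))
  /-- the images of the generators in `Γ` -/
  gen : Fin (m + 1) → Γ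
  rel_crossing : ∀ a, ∃ i j k : Fin (m + 1),
    rel a = FreeGroup.of i * FreeGroup.of j * (FreeGroup.of i)⁻¹ * (FreeGroup.of k)⁻¹ ∨
    rel a = (FreeGroup.of i)⁻¹ * FreeGroup.of j * FreeGroup.of i * (FreeGroup.of k)⁻¹
  gen_meridian : ∀ i, IsConj μ (gen i)
  surjective : Function.Surjective (FreeGroup.lift gen)
  ker_eq : (FreeGroup.lift gen).ker = Subgroup.normalClosure (Set.range rel)

variable {Γ : Type*} [Group Γ] {μ : Γ} {R : Type*} [CommRing R]
  {κ : Type*} [Fintype κ] [DecidableEq κ]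

/-- The homomorphism `φ ⊗ ϱ : Γ → Mat(k, R[t^{±1}])`, `s ↦ t^{φ(s)} ϱ(s)`. -/
def tensorHom (φ : Γ →* Multiplicative ℤ) (ϱ : Γ →* GL κ R) :
    Γ →* Matrix κ κ (LaurentPolynomial R) where
  toFun s := LaurentPolynomial.T (R := R) (Multiplicative.toAdd (φ s)) •
    (ϱ s : Matrix κ κ R).map LaurentPolynomial.C
  map_one' := by
    simp [LaurentPolynomial.T_zero]
  map_mul' s s' := by
    simp only [map_mul, toAdd_mul, LaurentPolynomial.T_add, Units.val_mul, Matrix.map_mul,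
      Matrix.smul_mul, Matrix.mul_smul, smul_smul]
    rw [mul_comm]

namespace WirtingerPresentation

/-- The ring homomorphism `Φ : ℤ[F] → ℤ[Γ] → Mat(k, R[t^{±1}])`. -/
def Phi (P : WirtingerPresentation Γ μ) (φ : Γ →* Multiplicative ℤ) (ϱ : Γ →* GL κ R) :
    MonoidAlgebra ℤ (FreeGroup (Fin (P.m + 1))) →ₐ[ℤ] Matrix κ κ (LaurentPolynomial R) :=
  MonoidAlgebra.lift ℤ _ _ ((tensorHom φ ϱ).comp (FreeGroup.lift P.gen))

/-- The matrix `M_j`: the block matrix `(Φ (∂ r_a / ∂ s_b))` without its `j`-th block column. -/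
def foxMatrix (P : WirtingerPresentation Γ μ) (φ : Γ →* Multiplicative ℤ) (ϱ : Γ →* GL κ R)
    (j : Fin (P.m + 1)) : Matrix (Fin P.m × κ) (Fin P.m × κ) (LaurentPolynomial R) :=
  Matrix.of fun a b => P.Phi φ ϱ (foxDeriv (j.succAbove b.1) (P.rel a.1)) a.2 b.2

/-- Wada's rational expression `det M_j / det Φ(s_j - 1)` in `Q(t)`, the field of fractions
of `R[t^{±1}]`. -/
def wada [IsDomain R] (P : WirtingerPresentation Γ μ) (φ : Γ →* Multiplicative ℤ)
    (ϱ : Γ →* GL κ R) (j : Fin (P.m + 1)) : FractionRing (LaurentPolynomial R) :=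
  algebraMap _ _ (P.foxMatrix φ ϱ j).det /
    algebraMap _ _ (P.Phi φ ϱ (MonoidAlgebra.of ℤ _ (FreeGroup.of j) - 1)).det

end WirtingerPresentation

/-- `Δ` is the twisted Alexander polynomial of `(Γ, μ)` associated with `ϱ`, which is defined up to
multiplication by `ε t^l` with `ε ∈ Rˣ` and `l ∈ ℤ`: the map `φ` is the abelianization
`Γ → ℤ = ⟨t⟩` with `φ(μ) = t`. -/
def IsTwistedAlexanderPolynomial [IsDomain R] (μ : Γ) (ϱ : Γ →* GL κ R)
    (Δ : FractionRing (LaurentPolynomial R)) : Prop :=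
  ∃ (φ : Γ →* Multiplicative ℤ) (P : WirtingerPresentation Γ μ) (j : Fin (P.m + 1))
    (ε : Rˣ) (l : ℤ),
    φ.ker = commutator Γ ∧ φ μ = Multiplicative.ofAdd 1 ∧
    Δ = algebraMap (LaurentPolynomial R) _
      (LaurentPolynomial.C (ε : R) * LaurentPolynomial.T l) * P.wada φ ϱ j

end TwistedAlexander

/-- The regular representation `G → GL(|G|, ℤ)`, the permutation representation of the right
multiplication: the basis (row) vector `x` is sent by `g` to the basis vector `x * g`. -/
def regularRep (G : Type*) [Group G] [Fintype G] [DecidableEq G] : G →* GL G ℤ :=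
  MonoidHom.toHomUnits
    { toFun := fun g => Matrix.of fun x y => if x * g = y then (1 : ℤ) else 0
      map_one' := by
        ext x y
        simp [Matrix.one_apply]
      map_mul' := fun g h => by
        ext x y
        simp only [Matrix.of_apply, Matrix.mul_apply, ite_mul, one_mul, zero_mul,
          Finset.sum_ite_eq, Finset.mem_univ, if_true, mul_assoc] }

/-! ### Knots in the 3-sphere -/

/-- The unit sphere `S³` of `ℝ⁴`. -/
abbrev S3 : Type := Metric.sphere (0 : EuclideanSpace ℝ (Fin 4)) 1

instance : Fact (Module.finrank ℝ (EuclideanSpace ℝ (Fin 4)) = 3 + 1) :=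
  ⟨by simp⟩

/-- An oriented (smooth) knot in `S³`: a smooth embedding of the (counterclockwise oriented)
circle. -/
structure OrientedKnot where
  /-- the embedding -/
  toFun : Circle → S3
  smoothEmbedding : Manifold.IsSmoothEmbedding (𝓡 1) (𝓡 3) ∞ toFun

namespace OrientedKnot

/-- An orientation preserving parametrization by `S¹ × ℂ` of a neighbourhood of the knot, with
`S¹ × {0}` parametrizing the knot. The open tubular neighbourhood proper is the image of the open
solid torus `S¹ × {|w| < 1}`. The sphere `S³` is oriented as the boundary of the unit ball: a basis
`v₁, v₂, v₃` of the tangent space at `x` is positive if `det(x, v₁, v₂, v₃) > 0`. -/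
structure Tube (K : OrientedKnot) where
  /-- the parametrization -/
  toFun : Circle × ℂ → S3
  smoothEmbedding : Manifold.IsSmoothEmbedding ((𝓡 1).prod 𝓘(ℝ, ℂ)) (𝓡 3) ∞ toFun
  core : ∀ z, toFun (z, 0) = K.toFun z
  orientation : ∀ (s : ℝ) (w : ℂ),
    let T : ℝ × ℂ → EuclideanSpace ℝ (Fin 4) := fun p => (toFun (Circle.exp p.1, p.2)).1
    0 < (Matrix.of ![(T (s, w)).ofLp, (fderiv ℝ T (s, w) (1, 0)).ofLp,
      (fderiv ℝ T (s, w) (0, 1)).ofLp, (fderiv ℝ T (s, w) (0, Complex.I)).ofLp]).det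

namespace Tube

variable {K : OrientedKnot} (N : K.Tube)

/-- The open tubular neighbourhood `ν(K)`. -/
def nu : Set S3 := N.toFun '' {p | ‖p.2‖ < 1}

/-- The exterior `E_K = S³ \ ν(K)`. -/
abbrev Exterior : Type := {x : S3 // x ∉ N.nu}

lemma boundary_notMem (z w : Circle) : N.toFun (z, (w : ℂ)) ∉ N.nu := by
  rintro ⟨p, hp, h⟩
  have h' := N.smoothEmbedding.isEmbedding.injective h
  subst h'
  simp [Circle.norm_coe] at hp

/-- The base point, on the boundary torus. -/
def base : N.Exterior := ⟨N.toFun (1, ((1 : Circle) : ℂ)), N.boundary_notMem 1 1⟩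

/-- The boundary of a fibre of the tubular neighbourhood, run through once counterclockwise. -/
def meridianPath : Path N.base N.base where
  toFun s := ⟨N.toFun (1, (Circle.exp (2 * Real.pi * s) : ℂ)), N.boundary_notMem _ _⟩
  continuous_toFun := by
    have h := N.smoothEmbedding.isEmbedding.continuous
    exact Continuous.subtype_mk (by fun_prop) _
  source' := by simp [base]
  target' := by simp [base]

/-- The knot group `G(K) = π₁(E_K)`. The product of Mathlib's fundamental group composes loops
from right to left, so that the usual group (first the left factor, then the right one) is its
opposite. -/
abbrev knotGroup : Type := (FundamentalGroup N.Exterior N.base)ᵐᵒᵖ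

/-- The oriented meridian `μ_K`. -/
def meridian : N.knotGroup :=
  MulOpposite.op (FundamentalGroup.fromPath (Path.Homotopic.Quotient.mk N.meridianPath))

end Tube

open Classical in
/-- The finite group `G` is a twisted Alexander vanishing group of the knot `K`: for some
epimorphism `f : G(K) → G` the twisted Alexander polynomial associated with `ρ ∘ f` is zero, where
`ρ` is the regular representation of `G`. -/
def IsTAVGroup (K : OrientedKnot) (G : Type*) [Group G] [Finite G] : Prop :=
  letI := Fintype.ofFinite G
  ∃ (N : K.Tube) (f : N.knotGroup →* G), Function.Surjective f ∧
    IsTwistedAlexanderPolynomial N.meridian ((regularRep G).comp f) 0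

/-- The knot `K` is fibered: its complement is a locally trivial bundle over the circle, which
near the knot is the map `(z, w) ↦ w / |w|` (so that the closures of the fibres are Seifert
surfaces of `K`). -/
def IsFibered (K : OrientedKnot) : Prop :=
  ∃ (N : K.Tube) (p : {x : S3 // x ∉ Set.range K.toFun} → Circle)
    (F : Type) (_ : TopologicalSpace F),
    (∀ b : Circle, ∃ e : Bundle.Trivialization F p, b ∈ e.baseSet) ∧
    ∀ x (z : Circle) (w : ℂ), w ≠ 0 → x.1 = N.toFun (z, w) → (p x : ℂ) = w / ‖w‖

open Classical in
/-- The TAV order `𝒪(K)`: `+∞` if `K` is fibered, and the least order of a TAV group of `K`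
otherwise. -/
def tavOrder (K : OrientedKnot) : ℕ∞ :=
  if K.IsFibered then ⊤ else
    sInf {n : ℕ∞ | ∃ (G : Type) (_ : Group G) (_ : Finite G), K.IsTAVGroup G ∧ n = Nat.card G}

end OrientedKnot

/-- The finite group `G` is a TAV group, that is, a TAV group of some knot. -/
def IsTAVGroup (G : Type*) [Group G] [Finite G] : Prop :=
  ∃ K : OrientedKnot, K.IsTAVGroup G

end

/-!
Expanding a crossed homomorphism by the fundamental formula of the free differential calculus
shows that, over a field, the numerator `det M_j` of Wada's invariant is nonzero if and only if the
only crossed homomorphism vanishing at `s_j` is zero (`RigidAt`). By reduction modulo a prime `p`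
and evaluation of `t` at `τ`, it therefore suffices to find a single unit `τ` of an algebraically
closed field of characteristic `p` at which the representation twisted by `τ ^ φ` is rigid.

The trivial module is rigid, because a crossed homomorphism with values in it is a homomorphism to
an abelian group and the generators are conjugate. Hence its twist by `τ ^ φ`, and by any other
character times `τ ^ φ`, is rigid for all but finitely many `τ`. If the commutator subgroup of the
finite group `G` is a `p`-group, then in characteristic `p` it fixes a nonzero vector of every
representation of `G`; since `G` has cyclic abelianization, `G` then has a common eigenvector, so
that every representation is an iterated extension of characters, and rigidity passes to
extensions.

Finally, the commutator subgroup of a group of order less than `24` with cyclic abelianization has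
prime power order.
-/

section SmallGroups

variable {G : Type*} [Group G]

lemma index_normalCore_dvd_factorial_index (H : Subgroup G) [H.FiniteIndex] :
    H.normalCore.index ∣ H.index.factorial := by
  have : Finite (G ⧸ H) := inferInstance
  rw [Subgroup.normalCore_eq_ker, Subgroup.index_ker, Subgroup.index_eq_card, ← Nat.card_perm]
  exact Subgroup.card_subgroup_dvd_card _

lemma exists_normal_isPGroup_of_not_dvd_factorial [Finite G] {p e : ℕ} [Fact p.Prime]
    (hdvd : p ^ e ∣ Nat.card G) (hfac : ¬ Nat.card G ∣ (Nat.card G / p ^ e).factorial) :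
    ∃ N : Subgroup G, N.Normal ∧ N ≠ ⊥ ∧ IsPGroup p N := by
  obtain ⟨H, hH⟩ := Sylow.exists_subgroup_card_pow_prime p hdvd
  refine ⟨H.normalCore, inferInstance, fun hbot => hfac ?_,
    (IsPGroup.of_card hH).to_le H.normalCore_le⟩
  have hindex : H.index = Nat.card G / p ^ e := by
    rw [← hH, ← H.card_mul_index, Nat.mul_div_cancel_left _ Nat.card_pos]
  rw [← hindex, ← Subgroup.index_bot, ← hbot]
  exact index_normalCore_dvd_factorial_index H

-- The bound is sharp: `30 / p ^ e ≥ 6` and `6! = 24 * 30`.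
lemma exists_prime_pow_dvd_not_dvd_factorial {n : ℕ} (h1 : 1 < n) (h30 : n < 30) :
    ∃ p e : ℕ, p.Prime ∧ p ^ e ∣ n ∧ ¬ n ∣ (n / p ^ e).factorial := by
  have key : ∀ n < 30, 1 < n → ∃ p < 30, ∃ e < 5, p.Prime ∧ p ^ e ∣ n ∧
      ¬ n ∣ (n / p ^ e).factorial := by decide +kernel
  obtain ⟨p, -, e, -, h⟩ := key n h30 h1
  exact ⟨p, e, h⟩

lemma isSolvable_of_card_lt_thirty [Finite G] (h30 : Nat.card G < 30) : Group.IsSolvable G := by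
  induction hn : Nat.card G using Nat.strong_induction_on generalizing G with
  | _ n ih =>
  subst hn
  obtain _ | _ := subsingleton_or_nontrivial G
  · infer_instance
  obtain ⟨p, e, hp, hdvd, hfac⟩ := exists_prime_pow_dvd_not_dvd_factorial Finite.one_lt_card h30
  have := Fact.mk hp
  obtain ⟨N, _, hN, hpN⟩ := exists_normal_isPGroup_of_not_dvd_factorial hdvd hfac
  have := hpN.isNilpotent
  have hlt : Nat.card (G ⧸ N) < Nat.card G := by
    rw [← N.card_mul_index, N.index_eq_card]
    exact lt_mul_of_one_lt_left Nat.card_pos (N.one_lt_card_iff_ne_bot.2 hN)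
  exact Group.isSolvable_iff_subgroup_quotient N |>.2
    ⟨inferInstance, ih _ hlt (hlt.trans h30) rfl⟩

lemma le_center_of_card_eq_two {N : Subgroup G} [hN : N.Normal] (h2 : Nat.card N = 2) :
    N ≤ Subgroup.center G := by
  obtain ⟨y, -, hy⟩ := (Nat.card_eq_two_iff' (1 : N)).1 h2
  have eq_y {z : G} (hz : z ∈ N) (hz1 : z ≠ 1) : z = y :=
    congrArg Subtype.val (hy ⟨z, hz⟩ (by simpa [Subtype.ext_iff] using hz1))
  intro x hx
  refine Subgroup.mem_center_iff.2 fun g => mul_inv_eq_iff_eq_mul.1 ?_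
  obtain rfl | hx1 := eq_or_ne x 1
  · group
  · exact (eq_y (hN.conj_mem x hx g) (by simpa using hx1)).trans (eq_y hx hx1).symm

lemma isCyclic_abelianization_of_surjective {H : Type*} [Group H] [IsCyclic (Abelianization G)]
    {f : G →* H} (hf : Function.Surjective f) : IsCyclic (Abelianization H) := by
  refine isCyclic_of_surjective (Abelianization.map f) fun y => ?_
  obtain ⟨h, rfl⟩ := QuotientGroup.mk_surjective y
  obtain ⟨g, rfl⟩ := hf h
  exact ⟨Abelianization.of g, rfl⟩

lemma card_commutator_ne_two [IsCyclic (Abelianization G)] : Nat.card (commutator G) ≠ 2 := by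
  intro h2
  have hcenter : (Abelianization.of : G →* _).ker ≤ Subgroup.center G :=
    (Abelianization.ker_of G).trans_le (le_center_of_card_eq_two h2)
  have := MonoidHom.isMulCommutative_of_isCyclic_of_ker_le_center _ hcenter
  rw [commutator_eq_bot, Subgroup.card_bot] at h2
  omega

lemma relIndex_commutator_ne_two [IsCyclic (Abelianization G)] (N : Subgroup G) [N.Normal] :
    N.relIndex (commutator G) ≠ 2 := by
  have : IsCyclic (Abelianization (G ⧸ N)) :=
    isCyclic_abelianization_of_surjective (QuotientGroup.mk'_surjective N)
  rw [← QuotientGroup.ker_mk' N, Subgroup.relIndex_ker, map_commutator_eq,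
    MonoidHom.range_eq_top.2 (QuotientGroup.mk'_surjective N), ← commutator_def]
  exact card_commutator_ne_two

lemma exists_characteristic_index_eq_two [Finite G] {p k : ℕ} (hp : p.Prime) (hp2 : p ≠ 2)
    (hcard : Nat.card G = p ^ k * 2) : ∃ H : Subgroup G, H.Characteristic ∧ H.index = 2 := by
  have := Fact.mk hp
  obtain ⟨H⟩ : Nonempty (Sylow p G) := inferInstance
  have hpow : Nat.card H = p ^ k := by
    rw [H.card_eq_multiplicity, hcard, Nat.factorization_mul (pow_ne_zero k hp.ne_zero) two_ne_zero]
    simp [hp.factorization, Nat.prime_two.factorization, hp2.symm]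
  have hindex : (H : Subgroup G).index = 2 := by
    have := (H : Subgroup G).card_mul_index
    rw [hcard, hpow] at this
    exact Nat.eq_of_mul_eq_mul_left (pow_pos hp.pos k) this
  exact ⟨H, H.characteristic_of_normal (Subgroup.normal_of_index_eq_two hindex), hindex⟩

lemma card_commutator_ne_prime_pow_mul_two [Finite G] [IsCyclic (Abelianization G)] {p : ℕ}
    (hp : p.Prime) (hp2 : p ≠ 2) (k : ℕ) : Nat.card (commutator G) ≠ p ^ k * 2 := by
  intro hcard
  obtain ⟨H, _, hH⟩ := exists_characteristic_index_eq_two hp hp2 hcard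
  refine relIndex_commutator_ne_two (H.map (commutator G).subtype) ?_
  rwa [Subgroup.relIndex, Subgroup.subgroupOf,
    Subgroup.comap_map_eq_self_of_injective (commutator G).subtype_injective]

lemma two_mul_card_commutator_le [Finite G] [Nontrivial G] [Group.IsSolvable G] :
    2 * Nat.card (commutator G) ≤ Nat.card G := by
  rw [← (commutator G).index_mul_card]
  gcongr
  exact Subgroup.one_lt_index_of_ne_top (Group.IsSolvable.commutator_lt_top_of_nontrivial G).ne

theorem exists_isPGroup_commutator [Finite G] [IsCyclic (Abelianization G)]
    (h24 : Nat.card G < 24) : ∃ p : ℕ, p.Prime ∧ IsPGroup p (commutator G) := by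
  have := isSolvable_of_card_lt_thirty (h24.trans (by norm_num))
  obtain _ | _ := subsingleton_or_nontrivial G
  · exact ⟨2, Nat.prime_two, IsPGroup.of_subsingleton 2 _⟩
  have hle := two_mul_card_commutator_le (G := G)
  have hsmall : ∀ d < 12, 0 < d ∧ d ≠ 3 * 2 ∧ d ≠ 5 * 2 →
      ∃ p < 12, ∃ k < 4, p.Prime ∧ d = p ^ k := by decide +kernel
  obtain ⟨p, -, k, -, hp, hcard⟩ := hsmall (Nat.card (commutator G)) (by omega)
    ⟨Nat.card_pos, card_commutator_ne_prime_pow_mul_two Nat.prime_three (by norm_num) 1,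
      card_commutator_ne_prime_pow_mul_two Nat.prime_five (by norm_num) 1⟩
  have := Fact.mk hp
  exact ⟨p, hp, IsPGroup.of_card hcard⟩

end SmallGroups

section CrossedHom

open Representation

variable {S Γ V U W : Type*} [CommRing S] [Group Γ] [AddCommGroup V] [Module S V]
  [AddCommGroup U] [Module S U] [AddCommGroup W] [Module S W]
  {ρ : Representation S Γ V} {d d' : Γ → V}

/-- A crossed homomorphism (or 1-cocycle) of a group with values in a representation. Unlike
`groupCohomology.cocycles₁` it does not ask the group and the scalars to be in one universe. -/
def IsCrossedHom (ρ : Representation S Γ V) (d : Γ → V) : Prop :=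
  ∀ g h, d (g * h) = d g + ρ g (d h)

namespace IsCrossedHom

lemma map_one (hd : IsCrossedHom ρ d) : d 1 = 0 := by
  simpa using hd 1 1

lemma sub (hd : IsCrossedHom ρ d) (hd' : IsCrossedHom ρ d') : IsCrossedHom ρ (d - d') := by
  intro g h
  simp only [Pi.sub_apply, hd g h, hd' g h, map_sub]
  abel

lemma comp {H : Type*} [Group H] (hd : IsCrossedHom ρ d) (π : H →* Γ) :
    IsCrossedHom (ρ.comp π) (d ∘ π) := by
  intro g h
  simp [hd (π g) (π h)]

lemma map {σ : Representation S Γ W} {f : V →ₗ[S] W} (hf : IsIntertwiningMap ρ σ f)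
    (hd : IsCrossedHom ρ d) : IsCrossedHom σ (f ∘ d) := by
  intro g h
  simp [hd g h, hf.isIntertwining]

/-- The subgroup on which a crossed homomorphism vanishes. -/
def zeros (hd : IsCrossedHom ρ d) : Subgroup Γ where
  carrier := {g | d g = 0}
  one_mem' := hd.map_one
  mul_mem' {g h} (hg : d g = 0) (hh : d h = 0) := by simp [hd g h, hg, hh]
  inv_mem' {g} (hg : d g = 0) := by
    simpa [hd.map_one, hg, eq_comm] using hd g⁻¹ g

lemma mem_zeros (hd : IsCrossedHom ρ d) {g : Γ} : g ∈ hd.zeros ↔ d g = 0 := Iff.rfl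

lemma eq_zero_of_closure_eq_top (hd : IsCrossedHom ρ d) {s : Set Γ}
    (hs : Subgroup.closure s = ⊤) (hzero : ∀ g ∈ s, d g = 0) : d = 0 := by
  have hle : Subgroup.closure s ≤ hd.zeros := (Subgroup.closure_le _).2 hzero
  exact funext fun g => hle (hs ▸ Subgroup.mem_top g)

lemma normalClosure_le_zeros (hd : IsCrossedHom ρ d) {s : Set Γ} (hs : ∀ g ∈ s, ρ g = 1)
    (hzero : ∀ g ∈ s, d g = 0) : Subgroup.normalClosure s ≤ hd.zeros := by
  refine (Subgroup.closure_le _).2 fun _ hg => ?_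
  obtain ⟨r, hr, hconj⟩ := Group.mem_conjugatesOfSet_iff.1 hg
  obtain ⟨c, rfl⟩ := isConj_iff.1 hconj
  have hc : d c + ρ c (d c⁻¹) = 0 := by rw [← hd, mul_inv_cancel, hd.map_one]
  rw [SetLike.mem_coe, mem_zeros, hd, hd, hzero r hr, map_zero, add_zero, map_mul, hs r hr,
    mul_one, hc]

lemma exists_factor {H : Type*} [Group H] {π : H →* Γ} (hπ : Function.Surjective π) {D : H → V}
    (hD : IsCrossedHom (ρ.comp π) D) (hker : π.ker ≤ hD.zeros) :
    ∃ d, IsCrossedHom ρ d ∧ d ∘ π = D := by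
  have hfactor (u w : H) (h : π u = π w) : D u = D w := by
    have hmem : w⁻¹ * u ∈ hD.zeros := hker (by simp [MonoidHom.mem_ker, h])
    simpa [hD.mem_zeros.1 hmem] using hD w (w⁻¹ * u)
  obtain ⟨d, rfl⟩ : ∃ d : Γ → V, d ∘ π = D :=
    ⟨fun g => D (Function.surjInv hπ g), funext fun u =>
      hfactor _ _ (Function.surjInv_eq hπ (π u))⟩
  refine ⟨d, fun g h => ?_, rfl⟩
  obtain ⟨u, rfl⟩ := hπ g
  obtain ⟨w, rfl⟩ := hπ h
  simpa using hD u w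

end IsCrossedHom

/-- A representation is rigid at `g` if a crossed homomorphism with values in it which vanishes at
`g` is zero. For `g` a generator of a deficiency one presentation this is the nonvanishing of the
numerator of Wada's invariant, see `WirtingerPresentation.det_foxJacobian_ne_zero_iff`. -/
def RigidAt (ρ : Representation S Γ V) (g : Γ) : Prop :=
  ∀ d, IsCrossedHom ρ d → d g = 0 → d = 0

namespace RigidAt

variable {σ : Representation S Γ W} {g : Γ}

lemma of_injective {f : V →ₗ[S] W} (hσ : RigidAt σ g) (hf : IsIntertwiningMap ρ σ f)
    (hinj : Function.Injective f) : RigidAt ρ g := by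
  intro d hd hg
  have hfd := hσ (f ∘ d) (hd.map hf) (by simp [hg])
  exact funext fun x => hinj (by simpa using congrFun hfd x)

lemma of_exact {τ : Representation S Γ U} {i : U →ₗ[S] V} {q : V →ₗ[S] W}
    (hτ : RigidAt τ g) (hσ : RigidAt σ g) (hi : IsIntertwiningMap τ ρ i)
    (hq : IsIntertwiningMap ρ σ q) (hinj : Function.Injective i) (hexact : Function.Exact i q) :
    RigidAt ρ g := by
  intro d hd hg
  have hqd := hσ (q ∘ d) (hd.map hq) (by simp [hg])
  choose e he using fun x => (hexact (d x)).1 (congrFun hqd x)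
  obtain rfl : i ∘ e = d := funext he
  have he0 : e = 0 := hτ e
    (fun x y => hinj (by simpa [hi.isIntertwining] using hd x y)) (hinj (by simpa using hg))
  exact funext fun x => by simp [he0]

end RigidAt

/-- The representation `χ ⊗ ρ`, where `χ` is a character. -/
def twist (χ : Γ →* Sˣ) (ρ : Representation S Γ V) : Representation S Γ V where
  toFun g := (χ g : S) • ρ g
  map_one' := by simp
  map_mul' g h := by rw [map_mul, map_mul, Units.val_mul, smul_mul_smul_comm]

lemma twist_apply (χ : Γ →* Sˣ) (ρ : Representation S Γ V) (g : Γ) (v : V) :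
    twist χ ρ g v = (χ g : S) • ρ g v := rfl

end CrossedHom

section MatrixRepresentation

open scoped Matrix

variable {S S' Γ H κ : Type*} [CommRing S] [CommRing S'] [Group Γ] [Group H] [Fintype κ]
  [DecidableEq κ]

/-- The representation on column vectors given by a multiplicative family of matrices. -/
noncomputable def matrixRep (A : Γ →* Matrix κ κ S) : Representation S Γ (κ → S) :=
  (Matrix.toLinAlgEquiv' : Matrix κ κ S ≃ₐ[S] _).toMonoidHom.comp A

lemma matrixRep_apply (A : Γ →* Matrix κ κ S) (g : Γ) (v : κ → S) :
    matrixRep A g v = A g *ᵥ v := rfl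

lemma map_monoidAlgebra_lift (h : S →+* S') (A : H →* Matrix κ κ S) (x : MonoidAlgebra ℤ H) :
    h.mapMatrix (MonoidAlgebra.lift ℤ _ _ A x) =
      MonoidAlgebra.lift ℤ _ _ (h.mapMatrix.toMonoidHom.comp A) x := by
  have heq : h.mapMatrix.comp (MonoidAlgebra.lift ℤ _ _ A).toRingHom =
      (MonoidAlgebra.lift ℤ _ _ (h.mapMatrix.toMonoidHom.comp A)).toRingHom :=
    MonoidAlgebra.ringHom_ext (fun n => by simp) fun g => by simp
  exact DFunLike.congr_fun heq x

end MatrixRepresentation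

section FoxCrossedHom

open scoped Matrix

variable {ι S κ : Type*} [Fintype ι] [DecidableEq ι] [CommRing S] [Fintype κ] [DecidableEq κ]

/-- The crossed homomorphism of a free group with the values `v i` at the letters, by the
fundamental formula of the free differential calculus. -/
noncomputable def foxCrossedHom (A : FreeGroup ι →* Matrix κ κ S) (v : ι → κ → S)
    (w : FreeGroup ι) : κ → S :=
  ∑ i, MonoidAlgebra.lift ℤ _ _ A (foxDeriv i w) *ᵥ v i

lemma isCrossedHom_foxCrossedHom (A : FreeGroup ι →* Matrix κ κ S) (v : ι → κ → S) :
    IsCrossedHom (matrixRep A) (foxCrossedHom A v) := by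
  intro u w
  simp only [foxCrossedHom, matrixRep_apply, foxDeriv_mul, map_add, map_mul,
    MonoidAlgebra.of_apply, MonoidAlgebra.lift_single, one_smul, Matrix.add_mulVec,
    Finset.sum_add_distrib, Matrix.mulVec_sum, Matrix.mulVec_mulVec]

lemma foxCrossedHom_of (A : FreeGroup ι →* Matrix κ κ S) (v : ι → κ → S) (i : ι) :
    foxCrossedHom A v (FreeGroup.of i) = v i := by
  simp only [foxCrossedHom, foxDeriv_of]
  rw [Finset.sum_eq_single i (fun b _ hb => by simp [hb.symm]) (by simp)]
  simp

lemma IsCrossedHom.eq_foxCrossedHom {A : FreeGroup ι →* Matrix κ κ S} {d : FreeGroup ι → κ → S}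
    (hd : IsCrossedHom (matrixRep A) d) : d = foxCrossedHom A fun i => d (FreeGroup.of i) := by
  refine sub_eq_zero.1 <| (hd.sub (isCrossedHom_foxCrossedHom A _)).eq_zero_of_closure_eq_top
    (FreeGroup.closure_range_of ι) ?_
  rintro _ ⟨i, rfl⟩
  simp [foxCrossedHom_of]

end FoxCrossedHom

section Evaluation

open LaurentPolynomial Filter

variable {Γ R k κ : Type*} [Group Γ] [CommRing R] [Fintype κ] [DecidableEq κ]

/-- The representation on `k ^ κ` obtained from `ϱ` by the change of scalars `h`. -/
noncomputable def scalarExtension [CommRing k] (h : R →+* k) (ϱ : Γ →* GL κ R) :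
    Representation k Γ (κ → k) :=
  matrixRep <| h.mapMatrix.toMonoidHom.comp <| (Units.coeHom _).comp ϱ

lemma matrixRep_eval₂_tensorHom [CommRing k] (h : R →+* k) (τ : kˣ) (φ : Γ →* Multiplicative ℤ)
    (ϱ : Γ →* GL κ R) :
    matrixRep ((eval₂ h τ).mapMatrix.toMonoidHom.comp (tensorHom φ ϱ)) =
      twist ((zpowersHom kˣ τ).comp φ) (scalarExtension h ϱ) := by
  refine MonoidHom.ext fun g => LinearMap.ext fun v => funext fun x => ?_
  simp [matrixRep_apply, twist_apply, scalarExtension, tensorHom, Matrix.mulVec, dotProduct,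
    Finset.mul_sum, mul_assoc, mul_left_comm]

lemma eventually_eval₂_ne_zero [Field k] {D : k[T;T⁻¹]} (hD : D ≠ 0) :
    ∀ᶠ τ : kˣ in cofinite, eval₂ (RingHom.id k) τ D ≠ 0 := by
  obtain ⟨n, f, hf⟩ := D.exists_T_pow
  have hf0 : f ≠ 0 := by
    rintro rfl
    rw [map_zero, eq_comm] at hf
    exact hD ((isUnit_T n).mul_left_eq_zero.1 hf)
  filter_upwards [Units.val_injective.tendsto_cofinite.eventually
    (Polynomial.eventually_cofinite_not_isRoot hf0)] with τ hτ hDτ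
  refine hτ ?_
  have := congrArg (eval₂ (RingHom.id k) τ) hf
  simpa [hDτ, eval₂_toLaurent] using this

end Evaluation

section PGroupRepresentations

variable {p : ℕ} [Fact p.Prime] {G k V : Type*} [Group G] [Finite G] [AddCommGroup V]

lemma exists_ne_zero_forall_apply_eq_self [CommRing k] [CharP k p] [Module k V] [Nontrivial V]
    (hG : IsPGroup p G) (ρ : Representation k G V) : ∃ v ≠ 0, ∀ g, ρ g v = v := by
  have hp (v : V) : p • v = 0 := by
    rw [← Nat.cast_smul_eq_nsmul k, CharP.cast_eq_zero, zero_smul]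
  obtain ⟨v₀, hv₀⟩ := exists_ne (0 : V)
  let _ : MulAction G V := MulAction.compHom V ρ
  let U : AddSubgroup V := AddSubgroup.closure (MulAction.orbit G v₀)
  have hU (g : G) : U ≤ U.comap (ρ g).toAddMonoidHom := by
    refine (AddSubgroup.closure_le _).2 fun v hv => ?_
    exact AddSubgroup.subset_closure (MulAction.mem_orbit_of_mem_orbit g hv)
  let U' : SubMulAction G V := ⟨U, fun g {v} hv => hU g hv⟩
  have hv₀U : v₀ ∈ U := AddSubgroup.subset_closure (MulAction.mem_orbit_self v₀)
  have : Finite (MulAction.orbit G v₀) := Finite.finite_mulAction_orbit v₀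
  have : AddGroup.FG U := AddGroup.closure_finite_fg (MulAction.orbit G v₀)
  have : Finite U := AddCommGroup.finite_of_fg_isAddTorsion U fun u =>
    isOfFinAddOrder_iff_nsmul_eq_zero.2 ⟨p, (Fact.out : p.Prime).pos, Subtype.ext (hp u)⟩
  have hcard : p ∣ Nat.card U := by
    rw [← addOrderOf_eq_prime (x := (⟨v₀, hv₀U⟩ : U)) (Subtype.ext (hp v₀))
      fun h => hv₀ (congrArg Subtype.val h)]
    exact addOrderOf_dvd_natCard _
  obtain ⟨u, hu, hu0⟩ := hG.exists_fixed_point_of_prime_dvd_card_of_fixed_point U' hcard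
    (a := ⟨0, U.zero_mem⟩) fun g => Subtype.ext (map_zero (ρ g))
  exact ⟨u, fun h => hu0 (Subtype.ext h.symm), fun g => congrArg Subtype.val (hu g)⟩

variable [Field k] [Module k V]

omit [Finite G] in
lemma exists_character_of_forall_apply_eq_smul {ρ : Representation k G V} {v : V} (hv : v ≠ 0)
    (h : ∀ g, ∃ c : k, ρ g v = c • v) : ∃ χ : G →* kˣ, ∀ g, ρ g v = (χ g : k) • v := by
  choose c hc using h
  have hinj := smul_left_injective k hv
  refine ⟨MonoidHom.toHomUnits ⟨⟨c, hinj ?_⟩, fun g g' => hinj ?_⟩, hc⟩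
  · simp [← hc]
  · simp only [← hc, map_mul, Module.End.mul_apply, mul_comm (c g), mul_smul]
    rw [hc g', map_smul]

lemma exists_common_eigenvector [IsAlgClosed k] [CharP k p] [FiniteDimensional k V] [Nontrivial V]
    [IsCyclic (Abelianization G)] (hG : IsPGroup p (commutator G)) (ρ : Representation k G V) :
    ∃ v ≠ 0, ∃ χ : G →* kˣ, ∀ g, ρ g v = (χ g : k) • v := by
  let W : Submodule k V := Representation.invariants (ρ.comp (commutator G).subtype)
  obtain ⟨v₀, hv₀, hfix⟩ :=
    exists_ne_zero_forall_apply_eq_self hG (ρ.comp (commutator G).subtype)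
  have : Nontrivial W := ⟨⟨v₀, hfix⟩, 0, fun h => hv₀ (congrArg Subtype.val h)⟩
  obtain ⟨a, ha⟩ := IsCyclic.exists_zpow_surjective (G := Abelianization G)
  obtain ⟨g, rfl⟩ := QuotientGroup.mk_surjective a
  obtain ⟨c, hc⟩ := Module.End.exists_eigenvalue
    ((ρ g).restrict (ρ.le_comap_invariants (commutator G) g))
  obtain ⟨⟨v, hvW⟩, hv⟩ := hc.exists_hasEigenvector
  have hv0 : v ≠ 0 := fun h => hv.2 (Subtype.ext h)
  have hgv : ρ g v = c • v := congrArg Subtype.val hv.apply_eq_smul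
  refine ⟨v, hv0, exists_character_of_forall_apply_eq_smul hv0 fun x => ?_⟩
  obtain ⟨n, hn : (QuotientGroup.mk g : Abelianization G) ^ n = QuotientGroup.mk x⟩ :=
    mem_powers_iff_mem_zpowers.2 (ha (QuotientGroup.mk x))
  have hcomm : (g ^ n)⁻¹ * x ∈ commutator G := QuotientGroup.eq.1 hn
  have hx : ρ x v = ρ (g ^ n) v := by
    rw [← mul_inv_cancel_left (g ^ n) x, map_mul, Module.End.mul_apply]
    exact congrArg _ (hvW ⟨_, hcomm⟩)
  have heig : Module.End.HasEigenvector (ρ g) c v :=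
    ⟨Module.End.mem_eigenspace_iff.2 hgv, hv0⟩
  exact ⟨c ^ n, by rw [hx, map_pow, heig.pow_apply]⟩

end PGroupRepresentations

namespace WirtingerPresentation

section FoxJacobian

open scoped Matrix

variable {Γ S S' κ : Type*} [Group Γ] {μ : Γ} [CommRing S] [CommRing S'] [Fintype κ]
  [DecidableEq κ] (P : WirtingerPresentation Γ μ) (A : Γ →* Matrix κ κ S) (j : Fin (P.m + 1))

/-- The block matrix of the free differentials of the relators with respect to the generators
other than the `j`-th one, evaluated in an arbitrary matrix representation; `foxMatrix` is the
case of `tensorHom φ ϱ`. -/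
noncomputable def foxJacobian : Matrix (Fin P.m × κ) (Fin P.m × κ) S :=
  Matrix.of fun a b => MonoidAlgebra.lift ℤ _ _ (A.comp (FreeGroup.lift P.gen))
    (foxDeriv (j.succAbove b.1) (P.rel a.1)) a.2 b.2

lemma map_det_foxJacobian (h : S →+* S') : h (P.foxJacobian A j).det =
    (P.foxJacobian (h.mapMatrix.toMonoidHom.comp A) j).det := by
  rw [RingHom.map_det]
  congr 1
  ext a b
  exact congrFun₂ (map_monoidAlgebra_lift h _ _) a.2 b.2

lemma foxJacobian_mulVec (v : Fin (P.m + 1) → κ → S) (hv : v j = 0) (a : Fin P.m) (x : κ) :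
    (P.foxJacobian A j *ᵥ fun b => v (j.succAbove b.1) b.2) (a, x) =
      foxCrossedHom (A.comp (FreeGroup.lift P.gen)) v (P.rel a) x := by
  rw [foxCrossedHom, Fin.sum_univ_succAbove _ j, hv, Matrix.mulVec_zero, zero_add]
  simp [foxJacobian, Matrix.mulVec, dotProduct, Fintype.sum_prod_type]

lemma rel_mem_ker (a : Fin P.m) : P.rel a ∈ (FreeGroup.lift P.gen).ker := by
  rw [P.ker_eq]
  exact Subgroup.subset_normalClosure ⟨a, rfl⟩

lemma closure_range_gen : Subgroup.closure (Set.range P.gen) = ⊤ := by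
  rw [← FreeGroup.range_lift_eq_closure, MonoidHom.range_eq_top.2 P.surjective]

lemma rigidAt_of_det_foxJacobian_ne_zero [IsDomain S] (hdet : (P.foxJacobian A j).det ≠ 0) :
    RigidAt (matrixRep A) (P.gen j) := by
  intro d hd hj
  have hfox := (hd.comp (FreeGroup.lift P.gen)).eq_foxCrossedHom (A := A.comp _)
  have hker : (P.foxJacobian A j *ᵥ fun b => d (P.gen (j.succAbove b.1)) b.2) = 0 := by
    ext ⟨a, x⟩
    rw [P.foxJacobian_mulVec A j (fun i => d (P.gen i)) hj]
    have hrel : d (FreeGroup.lift P.gen (P.rel a)) = 0 := by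
      rw [MonoidHom.mem_ker.1 (P.rel_mem_ker a), hd.map_one]
    simpa [hrel] using (congrFun₂ hfox (P.rel a) x).symm
  have hzero : (fun b : Fin P.m × κ => d (P.gen (j.succAbove b.1)) b.2) = 0 :=
    Matrix.eq_zero_of_mulVec_eq_zero hdet hker
  refine hd.eq_zero_of_closure_eq_top P.closure_range_gen ?_
  rintro _ ⟨i, rfl⟩
  obtain rfl | ⟨b, rfl⟩ := Fin.eq_self_or_eq_succAbove j i
  · exact hj
  · exact funext fun x => congrFun hzero (b, x)

lemma det_foxJacobian_ne_zero_of_rigidAt [IsDomain S] (h : RigidAt (matrixRep A) (P.gen j)) :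
    (P.foxJacobian A j).det ≠ 0 := by
  intro hdet
  obtain ⟨u, hu, hMu⟩ := Matrix.exists_mulVec_eq_zero_iff.2 hdet
  let v : Fin (P.m + 1) → κ → S := j.insertNth 0 fun b x => u (b, x)
  have hv : v j = 0 := Fin.insertNth_apply_same ..
  have hvu (b : Fin P.m) (x : κ) : v (j.succAbove b) x = u (b, x) := by
    simp only [v, Fin.insertNth_apply_succAbove]
  have hD := isCrossedHom_foxCrossedHom (A.comp (FreeGroup.lift P.gen)) v
  have hker : (FreeGroup.lift P.gen).ker ≤ hD.zeros := by
    rw [P.ker_eq]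
    refine hD.normalClosure_le_zeros ?_ ?_ <;> rintro _ ⟨a, rfl⟩
    · exact LinearMap.ext fun v => by
        simp [matrixRep_apply, MonoidHom.mem_ker.1 (P.rel_mem_ker a)]
    · ext x
      rw [← P.foxJacobian_mulVec A j v hv]
      simp only [hvu]
      exact congrFun hMu (a, x)
  obtain ⟨d, hd, hdD⟩ := IsCrossedHom.exists_factor (ρ := matrixRep A) P.surjective hD hker
  have hgen (i : Fin (P.m + 1)) : d (P.gen i) = v i := by
    rw [← foxCrossedHom_of (A.comp (FreeGroup.lift P.gen)) v i, ← hdD]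
    simp
  have hd0 : d = 0 := h d hd (by rw [hgen, hv])
  refine hu (funext fun ⟨b, x⟩ => ?_)
  rw [← hvu, ← hgen, hd0]
  rfl

theorem det_foxJacobian_ne_zero_iff [IsDomain S] :
    (P.foxJacobian A j).det ≠ 0 ↔ RigidAt (matrixRep A) (P.gen j) :=
  ⟨P.rigidAt_of_det_foxJacobian_ne_zero A j, P.det_foxJacobian_ne_zero_of_rigidAt A j⟩

end FoxJacobian

section Meridians

variable {Γ : Type*} [Group Γ] {μ : Γ} (P : WirtingerPresentation Γ μ)

lemma hom_apply_gen {A : Type*} [CommGroup A] (f : Γ →* A) (i : Fin (P.m + 1)) :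
    f (P.gen i) = f μ :=
  (isConj_iff_eq.1 (f.map_isConj (P.gen_meridian i))).symm

include P in
lemma hom_eq_of_apply_meridian {A : Type*} [CommGroup A] {f g : Γ →* A} (h : f μ = g μ) :
    f = g := by
  refine MonoidHom.eq_of_eqOn_dense P.closure_range_gen ?_
  rintro _ ⟨i, rfl⟩
  rw [P.hom_apply_gen, P.hom_apply_gen, h]

include P in
lemma isCyclic_abelianization : IsCyclic (Abelianization Γ) := by
  let Z : Subgroup (Abelianization Γ) := Subgroup.zpowers (Abelianization.of μ)
  have hZ : (QuotientGroup.mk' Z).comp Abelianization.of = 1 :=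
    P.hom_eq_of_apply_meridian <|
      (QuotientGroup.eq_one_iff _).2 (Subgroup.mem_zpowers (Abelianization.of μ))
  refine ⟨Abelianization.of μ, fun x => show x ∈ Z from (QuotientGroup.eq_one_iff x).1 ?_⟩
  obtain ⟨g, rfl⟩ := QuotientGroup.mk_surjective x
  exact DFunLike.congr_fun hZ g

lemma rigidAt_trivial (S V : Type*) [CommRing S] [AddCommGroup V] [Module S V]
    (j : Fin (P.m + 1)) : RigidAt (Representation.trivial S Γ V) (P.gen j) := by
  intro d hd hj
  let f : Γ →* Multiplicative V := MonoidHom.mk' (fun g => Multiplicative.ofAdd (d g)) hd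
  have hf : f = 1 := P.hom_eq_of_apply_meridian ((P.hom_apply_gen f j).symm.trans hj)
  exact funext fun g => DFunLike.congr_fun hf g

end Meridians

section FoxMatrixEvaluation

open LaurentPolynomial

variable {Γ R k κ : Type*} [Group Γ] {μ : Γ} [CommRing R] [Fintype κ] [DecidableEq κ]

lemma eval₂_det_foxMatrix_ne_zero_iff [CommRing k] [IsDomain k]
    (P : WirtingerPresentation Γ μ) (h : R →+* k) (τ : kˣ) (φ : Γ →* Multiplicative ℤ)
    (ϱ : Γ →* GL κ R) (j : Fin (P.m + 1)) : eval₂ h τ (P.foxMatrix φ ϱ j).det ≠ 0 ↔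
      RigidAt (twist ((zpowersHom kˣ τ).comp φ) (scalarExtension h ϱ)) (P.gen j) := by
  rw [← matrixRep_eval₂_tensorHom, ← det_foxJacobian_ne_zero_iff, ← map_det_foxJacobian]
  rfl

end FoxMatrixEvaluation

section Rigidity

open LaurentPolynomial Filter

variable {Γ k : Type*} [Group Γ] {μ : Γ} [Field k] (P : WirtingerPresentation Γ μ)
  (j : Fin (P.m + 1))

lemma eventually_rigidAt_twist_trivial (φ : Γ →* Multiplicative ℤ) : ∀ᶠ τ : kˣ in cofinite,
    RigidAt (twist ((zpowersHom kˣ τ).comp φ) (Representation.trivial k Γ k)) (P.gen j) := by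
  let D : k[T;T⁻¹] := (P.foxMatrix φ (1 : Γ →* GL Unit k) j).det
  have htriv : scalarExtension (RingHom.id k) (1 : Γ →* GL Unit k) =
      Representation.trivial k Γ (Unit → k) := by
    refine MonoidHom.ext fun g => LinearMap.ext fun v => ?_
    simp [scalarExtension, matrixRep_apply]
  have hD : D ≠ 0 := by
    suffices eval₂ (RingHom.id k) 1 D ≠ 0 from fun h => this (by rw [h, map_zero])
    rw [eval₂_det_foxMatrix_ne_zero_iff, htriv]
    convert P.rigidAt_trivial k (Unit → k) j
    refine MonoidHom.ext fun g => LinearMap.ext fun v => ?_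
    simp [twist_apply]
  filter_upwards [eventually_eval₂_ne_zero hD] with τ hτ
  rw [eval₂_det_foxMatrix_ne_zero_iff, htriv] at hτ
  exact hτ.of_injective (f := LinearMap.pi fun _ => LinearMap.id) ⟨fun g v => rfl⟩
    fun a b h => congrFun h ()

lemma eventually_rigidAt_twist_mul {φ : Γ →* Multiplicative ℤ}
    (hφ : φ μ = Multiplicative.ofAdd 1) (χ : Γ →* kˣ) : ∀ᶠ τ : kˣ in cofinite,
    RigidAt (twist ((zpowersHom kˣ τ).comp φ * χ) (Representation.trivial k Γ k)) (P.gen j) := by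
  filter_upwards [(mul_left_injective (χ μ)).tendsto_cofinite.eventually
    (P.eventually_rigidAt_twist_trivial j φ)] with τ hτ
  convert hτ using 2
  exact P.hom_eq_of_apply_meridian (by simp [hφ])

theorem eventually_rigidAt_of_isPGroup_commutator {φ : Γ →* Multiplicative ℤ}
    (hφ : φ μ = Multiplicative.ofAdd 1) {p : ℕ} [Fact p.Prime] [CharP k p] [IsAlgClosed k]
    {G V : Type*} [Group G] [Finite G] [IsCyclic (Abelianization G)]
    (hG : IsPGroup p (commutator G)) (f : Γ →* G) [AddCommGroup V] [Module k V]
    [FiniteDimensional k V] (ρ : Representation k G V) : ∀ᶠ τ : kˣ in cofinite,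
    RigidAt (twist ((zpowersHom kˣ τ).comp φ) (ρ.comp f)) (P.gen j) := by
  induction hn : Module.finrank k V using Nat.strong_induction_on generalizing V with
  | _ n ih =>
  subst hn
  cases subsingleton_or_nontrivial V with
  | inl h => exact .of_forall fun τ d _ _ => Subsingleton.elim _ _
  | inr h =>
  obtain ⟨v, hv, χ, hχ⟩ := exists_common_eigenvector hG ρ
  have hline (g : G) : k ∙ v ≤ (k ∙ v).comap (ρ g) := by
    rw [Submodule.span_singleton_le_iff_mem, Submodule.mem_comap, hχ]
    exact Submodule.smul_mem _ _ (Submodule.mem_span_singleton_self v)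
  have hrank : Module.finrank k (V ⧸ k ∙ v) < Module.finrank k V := by
    rw [← (k ∙ v).finrank_quotient_add_finrank, finrank_span_singleton hv]
    exact Nat.lt_succ_self _
  filter_upwards [P.eventually_rigidAt_twist_mul j hφ (χ.comp f),
    ih _ hrank (ρ.quotient (k ∙ v) hline) rfl] with τ hsub hquot
  refine hsub.of_exact (i := LinearMap.toSpanSingleton k V v) (q := (k ∙ v).mkQ) hquot
    ⟨fun g a => ?_⟩ ⟨fun g w => rfl⟩ (smul_left_injective k hv) ?_
  · simp [twist_apply, hχ, smul_smul, mul_comm]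
  · rw [LinearMap.exact_iff, Submodule.ker_mkQ, LinearMap.range_toSpanSingleton]

end Rigidity

section WadaInvariant

variable {Γ R κ : Type*} [Group Γ] {μ : Γ} [CommRing R] [Fintype κ] [DecidableEq κ]
  (P : WirtingerPresentation Γ μ) {φ : Γ →* Multiplicative ℤ} (j : Fin (P.m + 1))

theorem det_foxMatrix_ne_zero (hφ : φ μ = Multiplicative.ofAdd 1) {p : ℕ} [Fact p.Prime]
    {k : Type*} [Field k] [CharP k p] [IsAlgClosed k] (h : R →+* k) {G : Type*} [Group G]
    [Finite G] [IsCyclic (Abelianization G)] (hG : IsPGroup p (commutator G)) (f : Γ →* G)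
    (σ : G →* GL κ R) : (P.foxMatrix φ (σ.comp f) j).det ≠ 0 := by
  have : Infinite kˣ :=
    unitsEquivNeZero.infinite_iff.2 (Set.infinite_coe_iff.2 (Set.finite_singleton 0).infinite_compl)
  obtain ⟨τ, hτ⟩ :=
    (P.eventually_rigidAt_of_isPGroup_commutator j hφ hG f (scalarExtension h σ)).exists
  have heval := (P.eval₂_det_foxMatrix_ne_zero_iff h τ φ (σ.comp f) j).2 hτ
  exact fun hdet => heval (by rw [hdet, map_zero])

lemma det_Phi_of_sub_one_ne_zero [Nontrivial R] (hφ : φ μ = Multiplicative.ofAdd 1)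
    (ϱ : Γ →* GL κ R) :
    (P.Phi φ ϱ (MonoidAlgebra.of ℤ _ (FreeGroup.of j) - 1)).det ≠ 0 := by
  let A : Matrix κ κ R := (ϱ (P.gen j)).val
  have hPhi : P.Phi φ ϱ (MonoidAlgebra.of ℤ _ (FreeGroup.of j) - 1) =
      -Polynomial.toLaurent.mapMatrix (1 - (Polynomial.X : Polynomial R) • A.map Polynomial.C) := by
    rw [map_sub, map_one, map_sub, map_one, neg_sub]
    ext a b
    simp [Phi, tensorHom, P.hom_apply_gen, hφ, A]
  have hrev : A.charpolyRev ≠ 0 := fun h => by simpa [h] using A.eval_charpolyRev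
  rw [hPhi, Matrix.det_neg, ← RingHom.map_det, (isUnit_one.neg.pow _).mul_right_eq_zero.ne]
  exact (map_ne_zero_iff _ Polynomial.toLaurent_injective).2 hrev

end WadaInvariant

end WirtingerPresentation

theorem mainTheorem8_general {Γ : Type*} [Group Γ] {μ : Γ} {G : Type*} [Group G] [Finite G]
    {κ : Type*} [Fintype κ] [DecidableEq κ] (σ : G →* GL κ ℤ) (f : Γ →* G)
    (h : IsTwistedAlexanderPolynomial μ (σ.comp f) 0) : 24 ≤ Nat.card G := by
  obtain ⟨φ, P, j, ε, l, -, hφ, hzero⟩ := h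
  by_contra! hlt
  have : IsCyclic (Abelianization Γ) := P.isCyclic_abelianization
  have : IsCyclic (Abelianization f.range) :=
    isCyclic_abelianization_of_surjective f.rangeRestrict_surjective
  obtain ⟨p, hp, hcomm⟩ :=
    exists_isPGroup_commutator (f.range.card_le_card_group.trans_lt hlt)
  have := Fact.mk hp
  have hnum : (P.foxMatrix φ (σ.comp f) j).det ≠ 0 :=
    P.det_foxMatrix_ne_zero j hφ (Int.castRingHom (AlgebraicClosure (ZMod p))) hcomm
      f.rangeRestrict (σ.comp f.range.subtype)
  have hden := P.det_Phi_of_sub_one_ne_zero j hφ (σ.comp f)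
  refine absurd hzero.symm (mul_ne_zero ?_ (div_ne_zero ?_ ?_))
  · exact ((ε.isUnit.map _).mul (LaurentPolynomial.isUnit_T l)).map (algebraMap _ _) |>.ne_zero
  · simpa using hnum
  · simpa using hden

lemma OrientedKnot.IsTAVGroup.le_card {K : OrientedKnot} {G : Type*} [Group G] [Finite G]
    (h : K.IsTAVGroup G) : 24 ≤ Nat.card G := by
  classical
  let _ := Fintype.ofFinite G
  obtain ⟨_, f, -, hf⟩ := h
  exact mainTheorem8_general _ f hf

lemma OrientedKnot.le_tavOrder (K : OrientedKnot) : 24 ≤ K.tavOrder := by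
  rw [tavOrder]
  split_ifs
  · exact le_top
  · refine le_sInf ?_
    rintro _ ⟨G, _, _, hG, rfl⟩
    exact_mod_cast hG.le_card

theorem mainTheorem8 :
    (∀ K : OrientedKnot, 24 ≤ K.tavOrder) ∧
    ∀ (G : Type*) [Group G] [Finite G], IsTAVGroup G → 24 ≤ Nat.card G :=
  ⟨fun K => K.le_tavOrder, fun _ _ _ ⟨_, hK⟩ => hK.le_card⟩
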